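/- Let $d\ge 0$. For complex Hilbert spaces $\mathcal U,\mathcal V$, the Schur--Agler class $\mathcal{SA}_d(\mathcal U,\mathcal V)$ consists of the analytic functions $f(z)=\sum_{r\in\mathbb N_0^d} f_r z^r$ on the unit polydisk $\mathbb D^d$, with values in the bounded operators $\mathcal L(\mathcal U,\mathcal V)$, such that for every Hilbert space $\mathcal H$ and every $d$-tuple $T=(T_1,\dots,T_d)$ of commuting operators on $\mathcal H$ with $\|T_i\|<1$ the operator $f(T)=\sum_r f_r\otimes T^r$ from $\mathcal U\otimes\mathcal H$ to $\mathcal V\otimes\mathcal H$ (Hilbert-space tensor products, convergence in operator norm) is well defined and satisfies $\|f(T)\|\le 1$. A matrix-valued function is called Schur--Agler if it is so as a function with values in the operators on $\mathbb C^n$ with its Euclidean norm, and a scalar function if it is so as a function with values in $\mathcal L(\mathbb C,\mathbb C)$. Let $\mathcal V^{\vee k}\subseteq\mathcal V^{\otimes k}$ be the closed subspace of the Hilbert-space tensor power generated by the tensors $v_1\vee\cdots\vee v_k=\sum_{\sigma}v_{\sigma(1)}\otimes\cdots\otimes v_{\sigma(k)}$, where $\sigma$ runs over the permutations of $1,\dots,k$,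 and let $\pi_{\mathcal V^{\vee k}}$ be the orthogonal projection of $\mathcal V^{\otimes k}$ onto it. **Theorem.** Let $\mathcal U$ and $\mathcal V$ be Hilbert spaces and let $S_1,\dots,S_k\in\mathcal{SA}_d(\mathcal U,\mathcal V)$. Then the function $$(S_1\vee\cdots\vee S_k)(z)=\pi_{\mathcal V^{\vee k}}\,\bigl(S_1(z)\otimes\cdots\otimes S_k(z)\bigr)\big|_{\mathcal U^{\vee k}}$$ belongs to $\mathcal{SA}_d(\mathcal U^{\vee k},\mathcal V^{\vee k})$. **Corollary.** Let $S$ be an $n\times n$ matrix-valued Schur--Agler function on $\mathbb D^d$. Then for every $k$ the $k$-th permanental compound of $S$ is Schur--Agler, in both customary senses: the $\binom nk\times\binom nk$ matrix function with entries $\operatorname{per}S(z)[\alpha|\beta]$, where $\alpha,\beta$ run over the strictly increasing sequences of length $k$ in $\{1,\dots,n\}$; and the matrix of $S(z)^{\vee k}$ in the orthonormal basis of normalized symmetric tensors of standard basis vectors, with entries $\operatorname{per}S(z)[\alpha|\beta]/\sqrt{\mu(\alpha)\mu(\beta)}$, where $\alpha,\beta$ run over the nondecreasing sequences of length $k$ and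 $\mu(\alpha)$ is the product of the factorials of the multiplicities in $\alpha$. Here $S(z)[\alpha|\beta]$ is the $k\times k$ matrix with entries $S(z)_{\alpha_i\beta_j}$. In particular, the permanent $\operatorname{per}S(z)$ is a Schur--Agler function. -/

import Mathlib

open scoped TensorProduct

universe w u v

noncomputable section

/-! ### Hilbert-space tensor products -/

/-- The Hilbert-space tensor product: the completion of the algebraic tensor product for the
inner product determined by `⟪a ⊗ b, c ⊗ d⟫ = ⟪a, c⟫ * ⟪b, d⟫`. -/
abbrev HTensor (E : Type u) [NormedAddCommGroup E] [InnerProductSpace ℂ E]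
    (F : Type v) [NormedAddCommGroup F] [InnerProductSpace ℂ F] : Type (max u v) :=
  UniformSpace.Completion (E ⊗[ℂ] F)

/-- The bounded operator `A ⊗ B` between Hilbert-space tensor products. -/
def hmap {E E' F F' : Type*}
    [NormedAddCommGroup E] [InnerProductSpace ℂ E] [NormedAddCommGroup E'] [InnerProductSpace ℂ E']
    [NormedAddCommGroup F] [InnerProductSpace ℂ F] [NormedAddCommGroup F'] [InnerProductSpace ℂ F']
    (A : E →L[ℂ] E') (B : F →L[ℂ] F') : HTensor E F →L[ℂ] HTensor E' F' :=
  (TensorProduct.mapL A B).completion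

/-- A bundled complex Hilbert space, used only to define tensor powers by recursion. -/
structure HilbertBundle : Type (u + 1) where
  carrier : Type u
  [normed : NormedAddCommGroup carrier]
  [inner : InnerProductSpace ℂ carrier]
  [complete : CompleteSpace carrier]

attribute [instance] HilbertBundle.normed HilbertBundle.inner HilbertBundle.complete

/-- The tensor powers as bundled spaces: the zeroth one is the one-dimensional Hilbert space (a
copy of `ℂ` in the universe of `U`), the next one is the Hilbert-space tensor product of `U` with
the preceding one. -/
def tensorPowBundle (U : Type u) [NormedAddCommGroup U] [InnerProductSpace ℂ U] :
    ℕ → HilbertBundle.{u}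
  | 0 => ⟨EuclideanSpace ℂ PUnit.{u + 1}⟩
  | k + 1 => ⟨HTensor U (tensorPowBundle U k).carrier⟩

/-- The `k`-fold Hilbert-space tensor power of `U`. -/
abbrev HTensorPow (U : Type u) [NormedAddCommGroup U] [InnerProductSpace ℂ U] (k : ℕ) : Type u :=
  (tensorPowBundle U k).carrier

/-- The elementary tensor `v₁ ⊗ ⋯ ⊗ v_k`. -/
def elemTensor {U : Type u} [NormedAddCommGroup U] [InnerProductSpace ℂ U] :
    (k : ℕ) → (Fin k → U) → HTensorPow U k
  | 0, _ => (EuclideanSpace.single PUnit.unit 1 : EuclideanSpace ℂ PUnit.{u + 1})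
  | k + 1, x => ((x 0 ⊗ₜ[ℂ] elemTensor k (Fin.tail x) : U ⊗[ℂ] HTensorPow U k) :
      HTensor U (HTensorPow U k))

/-- The bounded operator `A₁ ⊗ ⋯ ⊗ A_k` between tensor powers. -/
def tensorPowMap {U : Type u} {V : Type v} [NormedAddCommGroup U] [InnerProductSpace ℂ U]
    [NormedAddCommGroup V] [InnerProductSpace ℂ V] :
    (k : ℕ) → (Fin k → (U →L[ℂ] V)) → (HTensorPow U k →L[ℂ] HTensorPow V k)
  | 0, _ => (LinearIsometryEquiv.piLpCongrLeft 2 ℂ ℂ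
      Equiv.punitEquivPUnit.{u + 1, v + 1} : EuclideanSpace ℂ PUnit.{u + 1} →L[ℂ]
        EuclideanSpace ℂ PUnit.{v + 1})
  | k + 1, A => hmap (A 0) (tensorPowMap k (Fin.tail A))

/-! ### Symmetric tensor powers -/

/-- The elementary symmetric tensor `v₁ ∨ ⋯ ∨ v_k = ∑_σ v_{σ(1)} ⊗ ⋯ ⊗ v_{σ(k)}`. -/
def symTensor {U : Type u} [NormedAddCommGroup U] [InnerProductSpace ℂ U] {k : ℕ}
    (x : Fin k → U) : HTensorPow U k :=
  ∑ σ : Equiv.Perm (Fin k), elemTensor k (x ∘ σ)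

/-- The `k`-th symmetric tensor power `U^{∨k}`: the closed subspace of the `k`-fold tensor power
generated by the elementary symmetric tensors. -/
abbrev SymPow (U : Type u) [NormedAddCommGroup U] [InnerProductSpace ℂ U] (k : ℕ) :
    Submodule ℂ (HTensorPow U k) :=
  (Submodule.span ℂ (Set.range (symTensor (U := U) (k := k)))).topologicalClosure

/-- `A₁ ∨ ⋯ ∨ A_k`: the compression of `A₁ ⊗ ⋯ ⊗ A_k` to an operator from `U^{∨k}` to
`V^{∨k}`. -/
def symProd {U : Type u} {V : Type v} [NormedAddCommGroup U] [InnerProductSpace ℂ U]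
    [NormedAddCommGroup V] [InnerProductSpace ℂ V] {k : ℕ} (A : Fin k → (U →L[ℂ] V)) :
    SymPow U k →L[ℂ] SymPow V k :=
  (SymPow V k).orthogonalProjectionOnto ∘L tensorPowMap k A ∘L (SymPow U k).subtypeL

/-! ### The Schur–Agler class -/

/-- The open unit polydisk in `ℂ^d`. -/
def polydisk (d : ℕ) : Set (Fin d → ℂ) := {z | ∀ i, ‖z i‖ < 1}

/-- A `d`-tuple of commuting strict contractions. -/
structure IsCommutingStrictContraction {d : ℕ} {H : Type w} [NormedAddCommGroup H]
    [InnerProductSpace ℂ H] (T : Fin d → (H →L[ℂ] H)) : Prop where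
  commute : ∀ i j, Commute (T i) (T j)
  norm_lt_one : ∀ i, ‖T i‖ < 1

/-- The monomial `T^r = T₁^{r₁} ⋯ T_d^{r_d}`. -/
def opMonomial {d : ℕ} {H : Type w} [NormedAddCommGroup H] [InnerProductSpace ℂ H]
    (T : Fin d → (H →L[ℂ] H)) (r : Fin d → ℕ) : H →L[ℂ] H :=
  (List.ofFn fun i => T i ^ r i).prod

/-- The term `c_r ⊗ T^r` of the series `f(T) = ∑_r c_r ⊗ T^r`, for `f(z) = ∑_r c_r z^r`. -/
def seriesTerm {d : ℕ} {U : Type u} {V : Type v} {H : Type w}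
    [NormedAddCommGroup U] [InnerProductSpace ℂ U] [NormedAddCommGroup V] [InnerProductSpace ℂ V]
    [NormedAddCommGroup H] [InnerProductSpace ℂ H]
    (c : (Fin d → ℕ) → (U →L[ℂ] V)) (T : Fin d → (H →L[ℂ] H)) (r : Fin d → ℕ) :
    HTensor U H →L[ℂ] HTensor V H :=
  hmap (c r) (opMonomial T r)

/-- The Schur–Agler class `SA_d(U, V)`: `f` is analytic on the polydisk, and, with
`f(z) = ∑_r c_r z^r` its power series there, the operator `f(T) = ∑_r c_r ⊗ T^r` is well defined
and of norm at most one for every `d`-tuple `T` of commuting strict contractions on a Hilbert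
space. The values of `f` off the polydisk play no role. -/
def IsSchurAgler {d : ℕ} {U : Type u} {V : Type v}
    [NormedAddCommGroup U] [InnerProductSpace ℂ U] [NormedAddCommGroup V] [InnerProductSpace ℂ V]
    (f : (Fin d → ℂ) → (U →L[ℂ] V)) : Prop :=
  AnalyticOnNhd ℂ f (polydisk d) ∧
  ∃ c : (Fin d → ℕ) → (U →L[ℂ] V),
    (∀ z ∈ polydisk d, HasSum (fun r => (∏ i, z i ^ r i) • c r) (f z)) ∧
    ∀ (H : Type w) [NormedAddCommGroup H] [InnerProductSpace ℂ H] [CompleteSpace H]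
      (T : Fin d → (H →L[ℂ] H)), IsCommutingStrictContraction T →
        Summable (seriesTerm c T) ∧ ‖∑' r, seriesTerm c T r‖ ≤ 1

/-- A matrix-valued function is Schur–Agler when it is so as a function with values in the
operators between the Euclidean spaces. -/
def IsMatrixSchurAgler {d : ℕ} {ι : Type u} [Fintype ι] [DecidableEq ι]
    (S : (Fin d → ℂ) → Matrix ι ι ℂ) : Prop :=
  IsSchurAgler.{w} fun z => Matrix.toEuclideanCLM (n := ι) (𝕜 := ℂ) (S z)

/-- A scalar function is Schur–Agler when it is so as a function with values in the operators
on `ℂ`. -/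
def IsScalarSchurAgler {d : ℕ} (f : (Fin d → ℂ) → ℂ) : Prop :=
  IsSchurAgler.{w} fun z => f z • ContinuousLinearMap.id ℂ ℂ

/-! ### Permanental compounds -/

/-- The `k`-th permanental compound of an `n × n` matrix: its entry at a pair of strictly
increasing index sequences of length `k` is the permanent of the corresponding submatrix. -/
def permCompound {n : ℕ} (k : ℕ) (A : Matrix (Fin n) (Fin n) ℂ) :
    Matrix (Fin k ↪o Fin n) (Fin k ↪o Fin n) ℂ :=
  Matrix.of fun α β => (A.submatrix α β).permanent

/-- The product of the factorials of the multiplicities of the values of `α`. -/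
def multFactorial {n k : ℕ} (α : Fin k → Fin n) : ℕ :=
  ∏ i : Fin n, (Finset.univ.filter fun j => α j = i).card.factorial

/-- The full `k`-th permanental compound (the `k`-th induced matrix) of an `n × n` matrix, which
is the matrix of `A^{∨k}` in the orthonormal basis of normalized tensors `e_{α₁} ∨ ⋯ ∨ e_{α_k}`:
it is indexed by nondecreasing sequences of length `k`, with the permanent of the corresponding
submatrix (with repetitions) divided by `√(μ(α) μ(β))` as its entry. -/
def permInduced {n : ℕ} (k : ℕ) (A : Matrix (Fin n) (Fin n) ℂ) :
    Matrix {α : Fin k → Fin n // Monotone α} {α : Fin k → Fin n // Monotone α} ℂ :=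
  Matrix.of fun α β => (A.submatrix α.1 β.1).permanent /
    (Real.sqrt (multFactorial α.1 * multFactorial β.1) : ℂ)

end

/-!
A product factors as `f ⊗ g = (f ⊗ 1) ∘ (1 ⊗ g)`. The Schur–Agler class is closed under composition:
by absolute convergence and `T ^ (p + q) = T ^ p * T ^ q`, the Cauchy product of the two power
series gives `(f g)(T) = f(T) g(T)`. It is closed under `f ↦ 1 ⊗ f`, because `(1 ⊗ f)(T)` is
`1 ⊗ f(T)` up to reassociation, and it contains the constant contractions. Hence it is closed under
tensor products and under compressions, in particular to the symmetric subspaces.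

Since `⟪x₁ ∨ ⋯ ∨ x_k, y₁ ∨ ⋯ ∨ y_k⟫ = k! per ⟪x_i, y_j⟫`, the normalized symmetric tensors of an
orthonormal basis, indexed by nondecreasing sequences, are orthonormal, and the permanental
compounds of `S` are the matrices of compressions of `S ⊗ ⋯ ⊗ S` to their spans.
-/

noncomputable section

/-- The Hilbert-space tensor product `HTensor E F` as a type of its own. Keeping the completion
folded hides its many further instances from unification, which matters once tensor products are
iterated. -/
def HilbTensor (E : Type u) [NormedAddCommGroup E] [InnerProductSpace ℂ E]
    (F : Type v) [NormedAddCommGroup F] [InnerProductSpace ℂ F] : Type (max u v) :=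
  HTensor E F

namespace HilbTensor

variable {E E' E'' F F' F'' G G' : Type*}
  [NormedAddCommGroup E] [InnerProductSpace ℂ E] [NormedAddCommGroup E'] [InnerProductSpace ℂ E']
  [NormedAddCommGroup E''] [InnerProductSpace ℂ E'']
  [NormedAddCommGroup F] [InnerProductSpace ℂ F] [NormedAddCommGroup F'] [InnerProductSpace ℂ F']
  [NormedAddCommGroup F''] [InnerProductSpace ℂ F'']
  [NormedAddCommGroup G] [InnerProductSpace ℂ G] [NormedAddCommGroup G'] [InnerProductSpace ℂ G']

instance : NormedAddCommGroup (HilbTensor E F) := inferInstanceAs (NormedAddCommGroup (HTensor E F))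

instance : InnerProductSpace ℂ (HilbTensor E F) :=
  inferInstanceAs (InnerProductSpace ℂ (HTensor E F))

instance : CompleteSpace (HilbTensor E F) := inferInstanceAs (CompleteSpace (HTensor E F))

variable (E F) in
/-- The elementary tensor `a ⊗ b`, as a bounded bilinear map of `a` and `b`. -/
def tmul : E →L[ℂ] F →L[ℂ] HilbTensor E F :=
  (ContinuousLinearMap.compL ℂ F (E ⊗[ℂ] F) (HTensor E F) UniformSpace.Completion.toComplL ∘L
    TensorProduct.mkL ℂ E F : E →L[ℂ] F →L[ℂ] HTensor E F)

theorem inner_tmul (a a' : E) (b b' : F) :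
    inner ℂ (tmul E F a b) (tmul E F a' b') = inner ℂ a a' * inner ℂ b b' :=
  (UniformSpace.Completion.inner_coe _ _).trans (TensorProduct.inner_tmul ..)

theorem induction_on {p : HilbTensor E F → Prop} (x : HilbTensor E F)
    (isClosed : IsClosed {x | p x}) (zero : p 0) (tmul : ∀ a b, p (tmul E F a b))
    (add : ∀ x y, p x → p y → p (x + y)) : p x := by
  refine UniformSpace.Completion.induction_on x isClosed fun x => ?_
  induction x with
  | zero => exact zero
  | tmul a b => exact tmul a b
  | add x y hx hy => exact UniformSpace.Completion.coe_add x y ▸ add _ _ hx hy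

theorem ext {K : Type*} [NormedAddCommGroup K] [NormedSpace ℂ K]
    {A B : HilbTensor E F →L[ℂ] K} (h : ∀ a b, A (tmul E F a b) = B (tmul E F a b)) : A = B := by
  ext x
  induction x using induction_on with
  | isClosed => exact isClosed_eq A.continuous B.continuous
  | zero => rw [map_zero, map_zero]
  | tmul a b => exact h a b
  | add x y hx hy => rw [map_add, map_add, hx, hy]

/-- The operator `A ⊗ B`, that is, `hmap A B`. -/
def map (A : E →L[ℂ] E') (B : F →L[ℂ] F') : HilbTensor E F →L[ℂ] HilbTensor E' F' :=
  hmap A B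

@[simp]
theorem map_tmul (A : E →L[ℂ] E') (B : F →L[ℂ] F') (a : E) (b : F) :
    map A B (tmul E F a b) = tmul E' F' (A a) (B b) :=
  ContinuousLinearMap.completion_apply_coe _ _

theorem map_comp (A : E' →L[ℂ] E'') (A' : E →L[ℂ] E') (B : F' →L[ℂ] F'') (B' : F →L[ℂ] F') :
    map (A ∘L A') (B ∘L B') = map A B ∘L map A' B' :=
  ext fun a b => by simp only [ContinuousLinearMap.comp_apply, map_tmul]

theorem norm_map_le (A : E →L[ℂ] E') (B : F →L[ℂ] F') : ‖map A B‖ ≤ ‖A‖ * ‖B‖ := by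
  refine ContinuousLinearMap.opNorm_le_bound _ (by positivity) fun x => ?_
  refine UniformSpace.Completion.induction_on x
    (isClosed_le (map A B).continuous.norm (by fun_prop)) fun x => ?_
  calc ‖hmap A B x‖ = ‖TensorProduct.mapL A B x‖ :=
        (congrArg norm (ContinuousLinearMap.completion_apply_coe _ x)).trans
          (UniformSpace.Completion.norm_coe _)
    _ ≤ ‖A‖ * ‖B‖ * ‖x‖ := ContinuousLinearMap.le_of_opNorm_le _ (TensorProduct.norm_mapL_le A B) x
    _ = _ := congrArg _ (UniformSpace.Completion.norm_coe x).symm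

variable (E E' F F') in
/-- The operator `A ⊗ B`, as a bounded bilinear map of `A` and `B`. -/
def mapL : (E →L[ℂ] E') →L[ℂ] (F →L[ℂ] F') →L[ℂ] (HilbTensor E F →L[ℂ] HilbTensor E' F') :=
  LinearMap.mkContinuous₂ (E := E →L[ℂ] E') (F := F →L[ℂ] F')
    (G := HilbTensor E F →L[ℂ] HilbTensor E' F')
    (LinearMap.mk₂ ℂ map
      (fun A A' B => ext fun a b => by simp only [_root_.add_apply, map_tmul, map_add])
      (fun t A B => ext fun a b => by simp only [_root_.smul_apply, map_tmul, map_smul])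
      (fun A B B' => ext fun a b => by simp only [_root_.add_apply, map_tmul, map_add])
      (fun t A B => ext fun a b => by simp only [_root_.smul_apply, map_tmul, map_smul]))
    1 fun A B => (norm_map_le A B).trans_eq (by rw [one_mul])

@[simp]
theorem mapL_apply (A : E →L[ℂ] E') (B : F →L[ℂ] F') : mapL E E' F F' A B = map A B := rfl

/-- The isometry on the Hilbert-space tensor product that extends a bilinear map multiplying inner
products. -/
def liftIsometry [CompleteSpace G] (B : E →L[ℂ] F →L[ℂ] G)
    (hB : ∀ a b a' b', inner ℂ (B a b) (B a' b') = inner ℂ a a' * inner ℂ b b') :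
    HilbTensor E F →ₗᵢ[ℂ] G :=
  let L : E ⊗[ℂ] F →ₗᵢ[ℂ] G := (TensorProduct.lift B.toLinearMap₁₂).isometryOfInner fun x y => by
    induction x with
    | zero => simp
    | add x x' hx hx' => simp only [map_add, inner_add_left, hx, hx']
    | tmul a b =>
      induction y with
      | zero => simp
      | add y y' hy hy' => simp only [map_add, inner_add_right, hy, hy']
      | tmul a' b' => simp [hB]
  let W : HTensor E F →L[ℂ] G := L.toContinuousLinearMap.fromCompletion
  { W with
    norm_map' := fun x => UniformSpace.Completion.induction_on x
      (isClosed_eq W.continuous.norm continuous_norm) fun x =>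
        (congrArg norm (L.toContinuousLinearMap.fromCompletion_apply_coe x)).trans
          ((L.norm_map x).trans (UniformSpace.Completion.norm_coe x).symm) }

theorem liftIsometry_tmul [CompleteSpace G] (B : E →L[ℂ] F →L[ℂ] G)
    (hB : ∀ a b a' b', inner ℂ (B a b) (B a' b') = inner ℂ a a' * inner ℂ b b') (a : E) (b : F) :
    liftIsometry B hB (tmul E F a b) = B a b :=
  (ContinuousLinearMap.fromCompletion_apply_coe _ _).trans (TensorProduct.lift.tmul a b)

variable (E F) in
/-- The flip `E ⊗ F → F ⊗ E`. -/
def comm : HilbTensor E F →ₗᵢ[ℂ] HilbTensor F E :=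
  liftIsometry (tmul F E).flip fun a b a' b' => (inner_tmul b b' a a').trans (mul_comm _ _)

@[simp]
theorem comm_tmul (a : E) (b : F) : comm E F (tmul E F a b) = tmul F E b a :=
  liftIsometry_tmul _ _ a b

theorem comm_comp_map_comp_comm (A : E →L[ℂ] E') (B : F →L[ℂ] F') :
    (comm F' E').toContinuousLinearMap ∘L map B A ∘L (comm E F).toContinuousLinearMap = map A B :=
  ext fun a b => by simp

theorem inner_map_id_tmul_flip (h h' : G) (x x' : HilbTensor E F) :
    inner ℂ (map (.id ℂ E) ((tmul F G).flip h) x) (map (.id ℂ E) ((tmul F G).flip h') x') =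
      inner ℂ x x' * inner ℂ h h' := by
  induction x using induction_on with
  | isClosed => exact isClosed_eq (by fun_prop) (by fun_prop)
  | zero => simp
  | add x y hx hy => simp only [map_add, inner_add_left, hx, hy, add_mul]
  | tmul a b =>
    induction x' using induction_on with
    | isClosed => exact isClosed_eq (by fun_prop) (by fun_prop)
    | zero => simp
    | add x y hx hy => simp only [map_add, inner_add_right, hx, hy, add_mul]
    | tmul a' b' => simp [inner_tmul, mul_assoc]

variable (E F G) in
/-- The associator `(E ⊗ F) ⊗ G → E ⊗ (F ⊗ G)`. -/
def assoc : HilbTensor (HilbTensor E F) G →ₗᵢ[ℂ] HilbTensor E (HilbTensor F G) :=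
  liftIsometry
    (ContinuousLinearMap.flip (E := G) (F := HilbTensor E F) (G := HilbTensor E (HilbTensor F G))
      (mapL E E F (HilbTensor F G) (.id ℂ E) ∘L (tmul F G).flip))
    fun x h x' h' => inner_map_id_tmul_flip h h' x x'

theorem assoc_tmul (x : HilbTensor E F) (h : G) :
    assoc E F G (tmul _ _ x h) = map (.id ℂ E) ((tmul F G).flip h) x :=
  liftIsometry_tmul _ _ _ _

theorem assoc_comp_map (A : E →L[ℂ] E') (B : F →L[ℂ] F') (C : G →L[ℂ] G') :
    (assoc E' F' G').toContinuousLinearMap ∘L map (map A B) C =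
      map A (map B C) ∘L (assoc E F G).toContinuousLinearMap := by
  refine ext fun x h => ?_
  have slice_comp_map : map (.id ℂ E') ((tmul F' G').flip (C h)) ∘L map A B =
      map A (map B C) ∘L map (.id ℂ E) ((tmul F G).flip h) :=
    ext fun a b => by simp
  simpa [assoc_tmul] using DFunLike.congr_fun slice_comp_map x

variable (E) in
/-- The ampliation `X ↦ 1 ⊗ X` of operators `X` between tensor products, with the factor `E`
absorbed on the left into the first leg. -/
def ampliation : (HilbTensor F G →L[ℂ] HilbTensor F' G') →L[ℂ]
    (HilbTensor (HilbTensor E F) G →L[ℂ] HilbTensor (HilbTensor E F') G') :=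
  ContinuousLinearMap.compL ℂ _ (HilbTensor E (HilbTensor F' G')) _
      (assoc E F' G').toContinuousLinearMap.adjoint ∘L
    (ContinuousLinearMap.compL ℂ _ (HilbTensor E (HilbTensor F G)) _).flip
      (assoc E F G).toContinuousLinearMap ∘L mapL E E _ _ (.id ℂ E)

theorem ampliation_map (A : F →L[ℂ] F') (B : G →L[ℂ] G') :
    ampliation E (map A B) = map (map (.id ℂ E) A) B := by
  change (assoc E F' G').toContinuousLinearMap.adjoint ∘L map (.id ℂ E) (map A B) ∘L
    (assoc E F G).toContinuousLinearMap = _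
  have adjoint_comp_assoc : (assoc E F' G').toContinuousLinearMap.adjoint ∘L
      (assoc E F' G').toContinuousLinearMap = 1 :=
    (ContinuousLinearMap.norm_map_iff_adjoint_comp_self _).1 (assoc E F' G').norm_map
  rw [← assoc_comp_map, ← ContinuousLinearMap.comp_assoc, adjoint_comp_assoc]
  exact ContinuousLinearMap.id_comp _

theorem norm_ampliation_apply_le (X : HilbTensor F G →L[ℂ] HilbTensor F' G') :
    ‖ampliation E X‖ ≤ ‖X‖ := by
  have norm_adjoint_le : ‖(assoc E F' G').toContinuousLinearMap.adjoint‖ ≤ 1 := by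
    rw [LinearIsometryEquiv.norm_map]
    exact (assoc E F' G').norm_toContinuousLinearMap_le
  calc ‖(assoc E F' G').toContinuousLinearMap.adjoint ∘L map (.id ℂ E) X ∘L
        (assoc E F G).toContinuousLinearMap‖
      ≤ ‖map (.id ℂ E) X ∘L (assoc E F G).toContinuousLinearMap‖ :=
        (ContinuousLinearMap.opNorm_comp_le _ _).trans
          (mul_le_of_le_one_left (norm_nonneg _) norm_adjoint_le)
    _ ≤ ‖map (.id ℂ E) X‖ :=
        (ContinuousLinearMap.opNorm_comp_le _ _).trans
          (mul_le_of_le_one_right (norm_nonneg _) (assoc E F G).norm_toContinuousLinearMap_le)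
    _ ≤ ‖X‖ :=
        (norm_map_le _ _).trans
          (mul_le_of_le_one_left (norm_nonneg _) ContinuousLinearMap.norm_id_le)

end HilbTensor

open Finset.HasAntidiagonal HilbTensor

section CauchyProduct

variable {𝕜 ι κ X Y Z : Type*} [NontriviallyNormedField 𝕜]
  [NormedAddCommGroup X] [NormedSpace 𝕜 X] [NormedAddCommGroup Y] [NormedSpace 𝕜 Y]
  [NormedAddCommGroup Z] [NormedSpace 𝕜 Z] [CompleteSpace Z]

theorem hasSum_bilinear_prod (B : X →L[𝕜] Y →L[𝕜] Z) {f : ι → X} {g : κ → Y} {a : X} {b : Y}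
    (hf : HasSum f a) (hg : HasSum g b) (hf' : Summable fun i => ‖f i‖)
    (hg' : Summable fun j => ‖g j‖) :
    HasSum (fun p : ι × κ => B (f p.1) (g p.2)) (B a b) := by
  have hs : Summable fun p : ι × κ => B (f p.1) (g p.2) := by
    refine .of_norm_bounded
      ((hf'.mul_of_nonneg hg' (fun _ => norm_nonneg _) fun _ => norm_nonneg _).mul_left ‖B‖)
      fun p => ?_
    rw [← mul_assoc]
    exact B.le_opNorm₂ _ _
  have hfiber : HasSum (fun i => B (f i) b) (∑' p : ι × κ, B (f p.1) (g p.2)) :=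
    hs.hasSum.prod_fiberwise fun i => (B (f i)).hasSum hg
  exact ((B.flip b).hasSum hf).unique hfiber ▸ hs.hasSum

theorem hasSum_sum_antidiagonal_bilinear {A : Type*} [AddMonoid A] [Finset.HasAntidiagonal A]
    (B : X →L[𝕜] Y →L[𝕜] Z) {f : A → X} {g : A → Y} {a : X} {b : Y}
    (hf : HasSum f a) (hg : HasSum g b) (hf' : Summable fun i => ‖f i‖)
    (hg' : Summable fun j => ‖g j‖) :
    HasSum (fun r => ∑ p ∈ antidiagonal r, B (f p.1) (g p.2)) (B a b) := by
  have hσ := (sigmaAntidiagonalEquivProd (A := A)).hasSum_iff.2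
    (hasSum_bilinear_prod B hf hg hf' hg')
  refine hσ.sigma fun r => ?_
  convert hasSum_fintype _
  exact (Finset.sum_coe_sort (antidiagonal r) fun p => B (f p.1) (g p.2)).symm

end CauchyProduct

section PowerSeries

theorem summable_prod_pow {d : ℕ} {t : Fin d → ℝ} (h0 : ∀ i, 0 ≤ t i) (h1 : ∀ i, t i < 1) :
    Summable fun r : Fin d → ℕ => ∏ i, t i ^ r i := by
  induction d with
  | zero => exact (hasSum_fintype _).summable
  | succ d ih =>
    rw [← (Fin.consEquiv fun _ : Fin (d + 1) => ℕ).summable_iff]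
    refine ((summable_geometric_of_lt_one (h0 0) (h1 0)).mul_of_nonneg
      (ih (fun i => h0 i.succ) fun i => h1 i.succ) (fun n => pow_nonneg (h0 0) n)
      fun r => Finset.prod_nonneg fun i _ => pow_nonneg (h0 i.succ) _).congr fun p => ?_
    simp [Fin.prod_univ_succ, Fin.consEquiv]

variable {d : ℕ} {X : Type*} [NormedAddCommGroup X] [NormedSpace ℂ X]

theorem summable_norm_mul_prod_pow {c : (Fin d → ℕ) → X}
    (hc : ∀ z ∈ polydisk d, Summable fun r => (∏ i, z i ^ r i) • c r) {t : Fin d → ℝ}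
    (h0 : ∀ i, 0 ≤ t i) (h1 : ∀ i, t i < 1) : Summable fun r => ‖c r‖ * ∏ i, t i ^ r i := by
  -- The terms at a polyradius `ρ` between `t` and `1` are bounded, so those at `t` are dominated by
  -- a product of geometric series with ratios `t i / ρ i`.
  choose ρ htρ hρ1 using fun i => exists_between (h1 i)
  have hρ (i) : 0 < ρ i := (h0 i).trans_lt (htρ i)
  have hz : (fun i => (ρ i : ℂ)) ∈ polydisk d := fun i => by
    simpa [abs_of_pos (hρ i)] using hρ1 i
  obtain ⟨M, hM⟩ := (hc _ hz).tendsto_cofinite_zero.norm.bddAbove_range_of_cofinite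
  have hcM (r) : (∏ i, ρ i ^ r i) * ‖c r‖ ≤ M := by
    simpa [norm_smul, abs_of_pos (hρ _)] using hM ⟨r, rfl⟩
  refine .of_nonneg_of_le
    (fun r => mul_nonneg (norm_nonneg _) (Finset.prod_nonneg fun i _ => pow_nonneg (h0 i) _))
    (fun r => ?_)
    ((summable_prod_pow (fun i => div_nonneg (h0 i) (hρ i).le)
      fun i => (div_lt_one (hρ i)).2 (htρ i)).mul_left M)
  calc ‖c r‖ * ∏ i, t i ^ r i
      = ((∏ i, ρ i ^ r i) * ‖c r‖) * ∏ i, (t i / ρ i) ^ r i := by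
        rw [mul_right_comm, ← Finset.prod_mul_distrib, mul_comm]
        simp only [← mul_pow, mul_div_cancel₀ _ (hρ _).ne']
    _ ≤ M * ∏ i, (t i / ρ i) ^ r i :=
        mul_le_mul_of_nonneg_right (hcM r)
          (Finset.prod_nonneg fun i _ => pow_nonneg (div_nonneg (h0 i) (hρ i).le) _)

theorem summable_norm_prod_pow_smul {c : (Fin d → ℕ) → X}
    (hc : ∀ z ∈ polydisk d, Summable fun r => (∏ i, z i ^ r i) • c r) {z : Fin d → ℂ}
    (hz : z ∈ polydisk d) : Summable fun r => ‖(∏ i, z i ^ r i) • c r‖ := by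
  simpa only [norm_smul, norm_prod, norm_pow, mul_comm] using
    summable_norm_mul_prod_pow hc (fun i => norm_nonneg (z i)) hz

end PowerSeries

section Monomials

theorem prod_ofFn_mul_distrib {M : Type*} [Monoid M] {d : ℕ} (f g : Fin d → M)
    (h : ∀ i j, Commute (f i) (g j)) :
    (List.ofFn fun i => f i * g i).prod = (List.ofFn f).prod * (List.ofFn g).prod := by
  induction d with
  | zero => simp
  | succ d ih =>
    have hc : Commute (g 0) (List.ofFn fun i : Fin d => f i.succ).prod :=
      .list_prod_right _ _ fun x hx => by
        obtain ⟨i, rfl⟩ := (List.mem_ofFn' _ _).1 hx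
        exact (h _ _).symm
    simp only [List.ofFn_succ, List.prod_cons, ih _ _ fun i j => h i.succ j.succ]
    rw [mul_assoc, mul_assoc, ← mul_assoc (g 0), hc.eq, mul_assoc]

variable {d : ℕ} {H : Type*} [NormedAddCommGroup H] [InnerProductSpace ℂ H]

theorem opMonomial_zero (T : Fin d → (H →L[ℂ] H)) : opMonomial T 0 = 1 := by
  simp [opMonomial]

theorem opMonomial_add {T : Fin d → (H →L[ℂ] H)} (hT : ∀ i j, Commute (T i) (T j))
    (p q : Fin d → ℕ) : opMonomial T (p + q) = opMonomial T p * opMonomial T q := by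
  simp only [opMonomial, Pi.add_apply, pow_add]
  exact prod_ofFn_mul_distrib _ _ fun i j => (hT i j).pow_pow _ _

theorem norm_opMonomial_le (T : Fin d → (H →L[ℂ] H)) (r : Fin d → ℕ) :
    ‖opMonomial T r‖ ≤ ∏ i, ‖T i‖ ^ r i := by
  rcases subsingleton_or_nontrivial H with _ | _
  · rw [Subsingleton.elim (opMonomial T r) 0, norm_zero]
    positivity
  · calc ‖opMonomial T r‖ ≤ ((List.ofFn fun i => T i ^ r i).map norm).prod := List.norm_prod_le _
      _ = ∏ i, ‖T i ^ r i‖ := by rw [List.map_ofFn, List.prod_ofFn]; rfl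
      _ ≤ ∏ i, ‖T i‖ ^ r i :=
        Finset.prod_le_prod (fun _ _ => norm_nonneg _) fun i _ => norm_pow_le (T i) (r i)

end Monomials

instance (d : ℕ) : Finset.HasAntidiagonal (Fin d → ℕ) := antidiagonalOfLocallyFinite

section SchurAgler

variable {d : ℕ} {U V W U' V' : Type*}
  [NormedAddCommGroup U] [InnerProductSpace ℂ U] [NormedAddCommGroup V] [InnerProductSpace ℂ V]
  [NormedAddCommGroup W] [InnerProductSpace ℂ W]
  [NormedAddCommGroup U'] [InnerProductSpace ℂ U'] [NormedAddCommGroup V'] [InnerProductSpace ℂ V']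

theorem isSchurAgler_iff {f : (Fin d → ℂ) → (U →L[ℂ] V)} : IsSchurAgler.{w} f ↔
    AnalyticOnNhd ℂ f (polydisk d) ∧ ∃ c : (Fin d → ℕ) → (U →L[ℂ] V),
      (∀ z ∈ polydisk d, HasSum (fun r => (∏ i, z i ^ r i) • c r) (f z)) ∧
      ∀ (H : Type w) [NormedAddCommGroup H] [InnerProductSpace ℂ H] [CompleteSpace H]
        (T : Fin d → (H →L[ℂ] H)), IsCommutingStrictContraction T →
          ∃ fT : HilbTensor U H →L[ℂ] HilbTensor V H,
            HasSum (fun r => map (c r) (opMonomial T r)) fT ∧ ‖fT‖ ≤ 1 := by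
  have summable_and_le_iff (c : (Fin d → ℕ) → (U →L[ℂ] V)) (H : Type w) [NormedAddCommGroup H]
      [InnerProductSpace ℂ H] (T : Fin d → (H →L[ℂ] H)) :
      (Summable (seriesTerm c T) ∧ ‖∑' r, seriesTerm c T r‖ ≤ 1) ↔
        ∃ fT : HilbTensor U H →L[ℂ] HilbTensor V H,
          HasSum (fun r => map (c r) (opMonomial T r)) fT ∧ ‖fT‖ ≤ 1 :=
    ⟨fun h => ⟨_, h.1.hasSum, h.2⟩, fun ⟨_, hfT, hle⟩ => ⟨hfT.summable, hfT.tsum_eq.symm ▸ hle⟩⟩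
  simp only [IsSchurAgler, summable_and_le_iff]

theorem isSchurAgler_const {A : U →L[ℂ] V} (hA : ‖A‖ ≤ 1) :
    IsSchurAgler.{w} fun _ : Fin d → ℂ => A := by
  refine isSchurAgler_iff.2 ⟨analyticOnNhd_const, Pi.single 0 A, fun z _ => ?_,
    fun H _ _ _ T _ => ⟨map A 1, ?_, ?_⟩⟩
  · convert hasSum_single (f := fun r => (∏ i, z i ^ r i) • (Pi.single 0 A : (Fin d → ℕ) → _) r)
      0 fun r hr => by simp only [Pi.single_eq_of_ne hr, smul_zero]
    simp
  · convert hasSum_single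
      (f := fun r => map ((Pi.single 0 A : (Fin d → ℕ) → _) r) (opMonomial T r))
      0 fun r hr => by rw [Pi.single_eq_of_ne hr, ← mapL_apply, map_zero, _root_.zero_apply]
    · rw [Pi.single_eq_same]
    · exact (opMonomial_zero T).symm
  · exact (norm_map_le _ _).trans
      (mul_le_one₀ hA (norm_nonneg _) ContinuousLinearMap.norm_id_le)

theorem hasSum_prod_pow_smul_antidiagonal_comp [CompleteSpace W]
    {a : (Fin d → ℕ) → (V →L[ℂ] W)} {b : (Fin d → ℕ) → (U →L[ℂ] V)}
    (ha : ∀ z ∈ polydisk d, Summable fun r => (∏ i, z i ^ r i) • a r)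
    (hb : ∀ z ∈ polydisk d, Summable fun r => (∏ i, z i ^ r i) • b r)
    {z : Fin d → ℂ} (hz : z ∈ polydisk d) {A : V →L[ℂ] W} {B : U →L[ℂ] V}
    (hA : HasSum (fun r => (∏ i, z i ^ r i) • a r) A)
    (hB : HasSum (fun r => (∏ i, z i ^ r i) • b r) B) :
    HasSum (fun r => (∏ i, z i ^ r i) • ∑ p ∈ antidiagonal r, a p.1 ∘L b p.2) (A ∘L B) := by
  refine (hasSum_sum_antidiagonal_bilinear (ContinuousLinearMap.compL ℂ U V W) hA hB
    (summable_norm_prod_pow_smul ha hz) (summable_norm_prod_pow_smul hb hz)).congr_fun fun r => ?_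
  rw [Finset.smul_sum]
  refine Finset.sum_congr rfl fun p hp => ?_
  obtain rfl := mem_antidiagonal.1 hp
  rw [ContinuousLinearMap.compL_apply, ContinuousLinearMap.smul_comp,
    ContinuousLinearMap.comp_smul, smul_smul, ← Finset.prod_mul_distrib]
  simp only [Pi.add_apply, pow_add]

theorem summable_norm_map_opMonomial {H : Type*} [NormedAddCommGroup H] [InnerProductSpace ℂ H]
    {c : (Fin d → ℕ) → (U →L[ℂ] V)}
    (hc : ∀ z ∈ polydisk d, Summable fun r => (∏ i, z i ^ r i) • c r)
    {T : Fin d → (H →L[ℂ] H)} (hT : ∀ i, ‖T i‖ < 1) :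
    Summable fun r => ‖map (c r) (opMonomial T r)‖ :=
  .of_nonneg_of_le (fun _ => norm_nonneg _)
    (fun r => (norm_map_le _ _).trans
      (mul_le_mul_of_nonneg_left (norm_opMonomial_le T r) (norm_nonneg _)))
    (summable_norm_mul_prod_pow hc (fun _ => norm_nonneg _) hT)

theorem hasSum_map_antidiagonal_comp_opMonomial {H : Type*} [NormedAddCommGroup H]
    [InnerProductSpace ℂ H] {a : (Fin d → ℕ) → (V →L[ℂ] W)} {b : (Fin d → ℕ) → (U →L[ℂ] V)}
    (ha : ∀ z ∈ polydisk d, Summable fun r => (∏ i, z i ^ r i) • a r)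
    (hb : ∀ z ∈ polydisk d, Summable fun r => (∏ i, z i ^ r i) • b r)
    {T : Fin d → (H →L[ℂ] H)} (hT : IsCommutingStrictContraction T)
    {A : HilbTensor V H →L[ℂ] HilbTensor W H} {B : HilbTensor U H →L[ℂ] HilbTensor V H}
    (hA : HasSum (fun r => map (a r) (opMonomial T r)) A)
    (hB : HasSum (fun r => map (b r) (opMonomial T r)) B) :
    HasSum (fun r => map (∑ p ∈ antidiagonal r, a p.1 ∘L b p.2) (opMonomial T r)) (A ∘L B) := by
  refine (hasSum_sum_antidiagonal_bilinear (X := HilbTensor V H →L[ℂ] HilbTensor W H)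
    (Y := HilbTensor U H →L[ℂ] HilbTensor V H) (Z := HilbTensor U H →L[ℂ] HilbTensor W H)
    (ContinuousLinearMap.compL ℂ _ _ _) hA hB
    (summable_norm_map_opMonomial ha hT.norm_lt_one)
    (summable_norm_map_opMonomial hb hT.norm_lt_one)).congr_fun fun r => ?_
  rw [← mapL_apply, map_sum, _root_.sum_apply]
  refine Finset.sum_congr rfl fun p hp => ?_
  obtain rfl := mem_antidiagonal.1 hp
  rw [mapL_apply, opMonomial_add hT.commute]
  exact map_comp _ _ _ _

theorem IsSchurAgler.comp [CompleteSpace W] {f : (Fin d → ℂ) → (V →L[ℂ] W)}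
    {g : (Fin d → ℂ) → (U →L[ℂ] V)} (hf : IsSchurAgler.{w} f) (hg : IsSchurAgler.{w} g) :
    IsSchurAgler.{w} fun z => f z ∘L g z := by
  obtain ⟨hfan, a, ha, haT⟩ := isSchurAgler_iff.1 hf
  obtain ⟨hgan, b, hb, hbT⟩ := isSchurAgler_iff.1 hg
  have ha' := fun z hz => (ha z hz).summable
  have hb' := fun z hz => (hb z hz).summable
  refine isSchurAgler_iff.2
    ⟨((ContinuousLinearMap.compL ℂ U V W).analyticOnNhd_bilinear Set.univ).comp₂ hfan hgan
      fun _ _ => trivial, fun r => ∑ p ∈ antidiagonal r, a p.1 ∘L b p.2,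
      fun z hz => hasSum_prod_pow_smul_antidiagonal_comp ha' hb' hz (ha z hz) (hb z hz),
      fun H _ _ _ T hT => ?_⟩
  obtain ⟨fT, hfT, hfT_le⟩ := haT H T hT
  obtain ⟨gT, hgT, hgT_le⟩ := hbT H T hT
  exact ⟨fT ∘L gT, hasSum_map_antidiagonal_comp_opMonomial ha' hb' hT hfT hgT,
    (ContinuousLinearMap.opNorm_comp_le _ _).trans (mul_le_one₀ hfT_le (norm_nonneg _) hgT_le)⟩

theorem IsSchurAgler.compression [CompleteSpace V'] {f : (Fin d → ℂ) → (U →L[ℂ] V)}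
    (hf : IsSchurAgler.{w} f) {A : V →L[ℂ] V'} {B : U' →L[ℂ] U} (hA : ‖A‖ ≤ 1) (hB : ‖B‖ ≤ 1) :
    IsSchurAgler.{w} fun z => A ∘L f z ∘L B :=
  ((isSchurAgler_const hA).comp hf).comp (isSchurAgler_const hB)

theorem IsSchurAgler.id_tensor {f : (Fin d → ℂ) → (U →L[ℂ] V)} (hf : IsSchurAgler.{w} f) :
    IsSchurAgler.{w} fun z => map (.id ℂ W) (f z) := by
  obtain ⟨han, c, hc, hT⟩ := isSchurAgler_iff.1 hf
  refine isSchurAgler_iff.2 ⟨(mapL W W U V (.id ℂ W)).comp_analyticOnNhd han,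
    fun r => map (.id ℂ W) (c r), fun z hz => ?_, fun H _ _ _ T hTc => ?_⟩
  · simpa using (mapL W W U V (.id ℂ W)).hasSum (hc z hz)
  · obtain ⟨fT, hfT, hfT_le⟩ := hT H T hTc
    exact ⟨ampliation W fT, by simpa only [ampliation_map] using (ampliation W).hasSum hfT,
      (norm_ampliation_apply_le _).trans hfT_le⟩

theorem IsSchurAgler.tensor_id {f : (Fin d → ℂ) → (U →L[ℂ] V)} (hf : IsSchurAgler.{w} f) :
    IsSchurAgler.{w} fun z => map (f z) (.id ℂ W) := by
  simpa only [comm_comp_map_comp_comm] using hf.id_tensor.compression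
    (comm W V).norm_toContinuousLinearMap_le (comm U W).norm_toContinuousLinearMap_le

theorem IsSchurAgler.tensor {f : (Fin d → ℂ) → (U →L[ℂ] V)} {g : (Fin d → ℂ) → (U' →L[ℂ] V')}
    (hf : IsSchurAgler.{w} f) (hg : IsSchurAgler.{w} g) :
    IsSchurAgler.{w} fun z => map (f z) (g z) := by
  simpa only [← map_comp, ContinuousLinearMap.comp_id, ContinuousLinearMap.id_comp] using
    hf.tensor_id.comp hg.id_tensor

end SchurAgler

section TensorPowers

variable {U : Type u} [NormedAddCommGroup U] [InnerProductSpace ℂ U]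
  {V : Type v} [NormedAddCommGroup V] [InnerProductSpace ℂ V] {d k : ℕ}

theorem inner_elemTensor (x y : Fin k → U) :
    inner ℂ (elemTensor k x) (elemTensor k y) = ∏ i, inner ℂ (x i) (y i) := by
  induction k with
  | zero =>
    change inner ℂ (EuclideanSpace.single PUnit.unit 1 : EuclideanSpace ℂ PUnit.{u + 1})
      (EuclideanSpace.single PUnit.unit 1) = _
    simp
  | succ k ih =>
    rw [Fin.prod_univ_succ]
    exact (inner_tmul (x 0) (y 0) (elemTensor k (Fin.tail x)) (elemTensor k (Fin.tail y))).trans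
      (congrArg _ (ih _ _))

theorem tensorPowMap_elemTensor (A : Fin k → (U →L[ℂ] V)) (x : Fin k → U) :
    tensorPowMap k A (elemTensor k x) = elemTensor k fun i => A i (x i) := by
  induction k with
  | zero =>
    change LinearIsometryEquiv.piLpCongrLeft 2 ℂ ℂ Equiv.punitEquivPUnit.{u + 1, v + 1}
      (EuclideanSpace.single PUnit.unit 1 : EuclideanSpace ℂ PUnit.{u + 1}) =
      (EuclideanSpace.single PUnit.unit 1 : EuclideanSpace ℂ PUnit.{v + 1})
    ext
    simp
  | succ k ih =>
    exact (map_tmul (A 0) (tensorPowMap k (Fin.tail A)) (x 0) (elemTensor k (Fin.tail x))).trans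
      (congrArg (tmul V (HTensorPow V k) (A 0 (x 0))) (ih _ _))

theorem isSchurAgler_tensorPowMap {S : Fin k → (Fin d → ℂ) → (U →L[ℂ] V)}
    (hS : ∀ j, IsSchurAgler.{w} (S j)) :
    IsSchurAgler.{w} fun z => tensorPowMap k fun j => S j z := by
  induction k with
  | zero =>
    exact isSchurAgler_const (U := EuclideanSpace ℂ PUnit.{u + 1})
      (V := EuclideanSpace ℂ PUnit.{v + 1}) (LinearIsometryEquiv.piLpCongrLeft 2 ℂ ℂ
        Equiv.punitEquivPUnit.{u + 1, v + 1}).toLinearIsometry.norm_toContinuousLinearMap_le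
  | succ k ih => exact (hS 0).tensor (ih fun j => hS j.succ)

theorem isSchurAgler_symProd {S : Fin k → (Fin d → ℂ) → (U →L[ℂ] V)}
    (hS : ∀ j, IsSchurAgler.{w} (S j)) :
    IsSchurAgler.{w} fun z => symProd fun j => S j z :=
  (isSchurAgler_tensorPowMap hS).compression
    (SymPow V k).orthogonalProjectionOnto_norm_le (SymPow U k).norm_subtypeL_le

theorem tensorPowMap_symTensor (A : U →L[ℂ] V) (x : Fin k → U) :
    tensorPowMap k (fun _ => A) (symTensor x) = symTensor (A ∘ x) := by
  simp only [symTensor, map_sum, tensorPowMap_elemTensor, Function.comp_def]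

theorem inner_symTensor (x y : Fin k → U) :
    inner ℂ (symTensor x) (symTensor y) =
      k.factorial * (Matrix.of fun i j => inner ℂ (x i) (y j)).permanent := by
  have sum_elemTensor (τ : Equiv.Perm (Fin k)) :
      ∑ σ : Equiv.Perm (Fin k), inner ℂ (elemTensor k (x ∘ σ)) (elemTensor k (y ∘ τ)) =
        (Matrix.of fun i j => inner ℂ (x i) (y j)).permanent := by
    simp only [inner_elemTensor, Function.comp_apply]
    exact Matrix.permanent_permute_rows τ (Matrix.of fun i j => inner ℂ (x i) (y j))
  simp only [symTensor, inner_sum, sum_inner, sum_elemTensor, Finset.sum_const, Finset.card_univ,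
    Fintype.card_perm, Fintype.card_fin, nsmul_eq_mul]

end TensorPowers

section Compression

variable {d : ℕ} {U : Type*} [NormedAddCommGroup U] [InnerProductSpace ℂ U]
  {f : (Fin d → ℂ) → (U →L[ℂ] U)} {ι : Type*} [Fintype ι] [DecidableEq ι]

theorem toEuclideanCLM_inner_basisFun (X : EuclideanSpace ℂ ι →L[ℂ] EuclideanSpace ℂ ι) :
    Matrix.toEuclideanCLM (𝕜 := ℂ) (Matrix.of fun i j =>
      inner ℂ (EuclideanSpace.basisFun ι ℂ i) (X (EuclideanSpace.basisFun ι ℂ j))) = X := by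
  refine ContinuousLinearMap.coe_injective ((EuclideanSpace.basisFun ι ℂ).toBasis.ext fun j => ?_)
  ext i
  simp [EuclideanSpace.inner_single_left]

theorem IsSchurAgler.isMatrixSchurAgler [CompleteSpace U] (hf : IsSchurAgler.{w} f) {e : ι → U}
    (he : Orthonormal ℂ e) :
    IsMatrixSchurAgler.{w} fun z => Matrix.of fun i j => inner ℂ (e i) (f z (e j)) := by
  let b := EuclideanSpace.basisFun ι ℂ
  have constr_apply (i) : b.toBasis.constr ℂ e (b i) = e i := by
    rw [← b.coe_toBasis, Module.Basis.constr_basis]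
  let J : EuclideanSpace ℂ ι →ₗᵢ[ℂ] U :=
    (b.toBasis.constr ℂ e).isometryOfOrthonormal (v := b.toBasis) (by simp)
      (by rwa [b.coe_toBasis, show _ ∘ b = e from funext constr_apply])
  have J_apply (i) : J.toContinuousLinearMap (b i) = e i := constr_apply i
  have J_le := J.norm_toContinuousLinearMap_le
  have adjoint_le : ‖J.toContinuousLinearMap.adjoint‖ ≤ 1 := by rwa [LinearIsometryEquiv.norm_map]
  unfold IsMatrixSchurAgler
  convert hf.compression adjoint_le J_le using 2 with z
  rw [← toEuclideanCLM_inner_basisFun (J.toContinuousLinearMap.adjoint ∘L f z ∘L _)]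
  simp only [ContinuousLinearMap.comp_apply, ContinuousLinearMap.adjoint_inner_right, b, J_apply]

theorem IsSchurAgler.isScalarSchurAgler (hf : IsSchurAgler.{w} f) {e : U} (he : ‖e‖ = 1) :
    IsScalarSchurAgler.{w} fun z => inner ℂ e (f z e) := by
  unfold IsScalarSchurAgler
  convert hf.compression (A := innerSL ℂ e) (B := ContinuousLinearMap.toSpanSingleton ℂ e)
    (by rw [innerSL_apply_norm, he]) (by rw [ContinuousLinearMap.norm_toSpanSingleton, he])
    using 2 with z
  ext
  simp

end Compression

section Permanents

variable {n k : ℕ}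

theorem permanent_one_submatrix {ι κ R : Type*} [DecidableEq ι] [Fintype κ] [DecidableEq κ]
    [CommSemiring R] (α β : κ → ι) :
    ((1 : Matrix ι ι R).submatrix α β).permanent =
      Fintype.card {σ : Equiv.Perm κ // α ∘ σ = β} := by
  rw [Matrix.permanent, Fintype.card_subtype, Finset.natCast_card_filter]
  refine Finset.sum_congr rfl fun σ _ => ?_
  simp only [Matrix.submatrix_apply, Matrix.one_apply, funext_iff, Function.comp_apply]
  rw [Finset.prod_ite_zero]
  simp

theorem permanent_one_submatrix_self {R : Type*} [CommSemiring R] (α : Fin k → Fin n) :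
    ((1 : Matrix (Fin n) (Fin n) R).submatrix α α).permanent = multFactorial α := by
  rw [permanent_one_submatrix, DomMulAct.stabilizer_card, multFactorial]
  simp only [Fintype.card_subtype]

theorem permanent_one_submatrix_of_ne {ι R : Type*} [PartialOrder ι] [DecidableEq ι]
    [CommSemiring R]
    {α β : Fin k → ι} (hα : Monotone α) (hβ : Monotone β) (hne : α ≠ β) :
    ((1 : Matrix ι ι R).submatrix α β).permanent = 0 := by
  have : IsEmpty {σ : Equiv.Perm (Fin k) // α ∘ σ = β} := by
    refine ⟨fun ⟨σ, hσ⟩ => hne ?_⟩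
    rw [← hσ]
    exact Tuple.unique_monotone (f := α) (σ := 1) (τ := σ) hα (hσ ▸ hβ)
  rw [permanent_one_submatrix, Fintype.card_of_isEmpty, Nat.cast_zero]

theorem multFactorial_pos (α : Fin k → Fin n) : 0 < multFactorial α :=
  Finset.prod_pos fun _ _ => Nat.factorial_pos _

theorem multFactorial_of_injective {α : Fin k → Fin n} (hα : Function.Injective α) :
    multFactorial α = 1 := by
  refine Finset.prod_eq_one fun i _ => Nat.factorial_eq_one.2 (Finset.card_le_one.2 ?_)
  simp only [Finset.mem_filter_univ]
  exact fun a ha b hb => hα (ha.trans hb.symm)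

variable {U : Type u} [NormedAddCommGroup U] [InnerProductSpace ℂ U]
  {V : Type v} [NormedAddCommGroup V] [InnerProductSpace ℂ V]

/-- The symmetric tensor `e_{α₁} ∨ ⋯ ∨ e_{α_k}`, scaled to have norm one when the family `e` is
orthonormal. -/
def normalizedSymTensor (e : Fin n → U) (α : Fin k → Fin n) : HTensorPow U k :=
  ((√(k.factorial * multFactorial α) : ℝ) : ℂ)⁻¹ • symTensor (e ∘ α)

theorem tensorPowMap_normalizedSymTensor (A : U →L[ℂ] V) (e : Fin n → U) (α : Fin k → Fin n) :
    tensorPowMap k (fun _ => A) (normalizedSymTensor e α) = normalizedSymTensor (A ∘ e) α := by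
  rw [normalizedSymTensor, map_smul, tensorPowMap_symTensor]
  rfl

theorem inner_normalizedSymTensor (e e' : Fin n → U) (α β : Fin k → Fin n) :
    inner ℂ (normalizedSymTensor e α) (normalizedSymTensor e' β) =
      ((Matrix.of fun i j => inner ℂ (e i) (e' j)).submatrix α β).permanent /
        (√(multFactorial α * multFactorial β) : ℂ) := by
  have sqrt_mul_sqrt : √(k.factorial * multFactorial α) * √(k.factorial * multFactorial β) =
      k.factorial * √(multFactorial α * multFactorial β) := by
    rw [← Real.sqrt_mul (by positivity), mul_mul_mul_comm, Real.sqrt_mul (by positivity),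
      Real.sqrt_mul_self (by positivity)]
  rw [normalizedSymTensor, normalizedSymTensor, inner_smul_left, inner_smul_right, inner_symTensor,
    map_inv₀, Complex.conj_ofReal, ← mul_assoc, ← mul_inv, ← Complex.ofReal_mul, sqrt_mul_sqrt,
    Complex.ofReal_mul, Complex.ofReal_natCast, inv_mul_eq_div,
    mul_div_mul_left _ _ (Nat.cast_ne_zero.2 k.factorial_ne_zero)]
  rfl

theorem orthonormal_normalizedSymTensor {e : Fin n → U} (he : Orthonormal ℂ e) :
    Orthonormal ℂ fun α : {α : Fin k → Fin n // Monotone α} => normalizedSymTensor e α.1 := by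
  have gram_eq_one : (Matrix.of fun i j => inner ℂ (e i) (e j)) = 1 := by
    ext i j
    rw [Matrix.of_apply, orthonormal_iff_ite.1 he, Matrix.one_apply]
  rw [orthonormal_iff_ite]
  rintro ⟨α, hα⟩ ⟨β, hβ⟩
  rw [inner_normalizedSymTensor, gram_eq_one]
  split_ifs with h
  · obtain rfl : α = β := congrArg Subtype.val h
    rw [permanent_one_submatrix_self, Real.sqrt_mul_self (Nat.cast_nonneg _)]
    exact div_self (Nat.cast_ne_zero.2 (multFactorial_pos α).ne')
  · rw [permanent_one_submatrix_of_ne hα hβ fun h' => h (Subtype.ext h'), zero_div]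

theorem inner_normalizedSymTensor_basisFun (M : Matrix (Fin n) (Fin n) ℂ) (α β : Fin k → Fin n) :
    inner ℂ (normalizedSymTensor (EuclideanSpace.basisFun (Fin n) ℂ) α)
        (tensorPowMap k (fun _ => Matrix.toEuclideanCLM (𝕜 := ℂ) M)
          (normalizedSymTensor (EuclideanSpace.basisFun (Fin n) ℂ) β)) =
      (M.submatrix α β).permanent / (√(multFactorial α * multFactorial β) : ℂ) := by
  have matrix_eq : (Matrix.of fun i j => inner ℂ (EuclideanSpace.basisFun (Fin n) ℂ i)
      (Matrix.toEuclideanCLM (𝕜 := ℂ) M (EuclideanSpace.basisFun (Fin n) ℂ j))) = M :=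
    Matrix.toEuclideanCLM.injective (toEuclideanCLM_inner_basisFun _)
  rw [tensorPowMap_normalizedSymTensor, inner_normalizedSymTensor]
  exact congrArg (fun N : Matrix _ _ ℂ => (N.submatrix α β).permanent / _) matrix_eq

variable {d : ℕ} {S : (Fin d → ℂ) → Matrix (Fin n) (Fin n) ℂ}

theorem IsMatrixSchurAgler.permInduced (hS : IsMatrixSchurAgler.{w} S) (k : ℕ) :
    IsMatrixSchurAgler.{w} fun z => permInduced k (S z) := by
  convert (isSchurAgler_tensorPowMap (k := k) fun _ => hS).isMatrixSchurAgler
    (orthonormal_normalizedSymTensor (EuclideanSpace.basisFun (Fin n) ℂ).orthonormal) using 2 with z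
  simp only [inner_normalizedSymTensor_basisFun]
  rfl

theorem IsMatrixSchurAgler.permCompound (hS : IsMatrixSchurAgler.{w} S) (k : ℕ) :
    IsMatrixSchurAgler.{w} fun z => permCompound k (S z) := by
  have he := (orthonormal_normalizedSymTensor (k := k)
    (EuclideanSpace.basisFun (Fin n) ℂ).orthonormal).comp
      (fun α : Fin k ↪o Fin n => (⟨α, α.monotone⟩ : {α : Fin k → Fin n // Monotone α}))
      fun α β h => DFunLike.coe_injective (congrArg Subtype.val h)
  convert (isSchurAgler_tensorPowMap (k := k) fun _ => hS).isMatrixSchurAgler he using 2 with z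
  ext α β
  simp [inner_normalizedSymTensor_basisFun, _root_.permCompound,
    multFactorial_of_injective α.injective, multFactorial_of_injective β.injective]

theorem IsMatrixSchurAgler.permanent (hS : IsMatrixSchurAgler.{w} S) :
    IsScalarSchurAgler.{w} fun z => (S z).permanent := by
  have he := (orthonormal_normalizedSymTensor (k := n)
    (EuclideanSpace.basisFun (Fin n) ℂ).orthonormal).norm_eq_one ⟨id, monotone_id⟩
  convert (isSchurAgler_tensorPowMap (k := n) fun _ => hS).isScalarSchurAgler he using 2 with z
  simp [inner_normalizedSymTensor_basisFun, multFactorial_of_injective Function.injective_id]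

end Permanents

end

theorem mainTheorem11_general (d : ℕ) :
    (∀ (U : Type u) [NormedAddCommGroup U] [InnerProductSpace ℂ U]
        (V : Type v) [NormedAddCommGroup V] [InnerProductSpace ℂ V]
        (k : ℕ) (S : Fin k → (Fin d → ℂ) → (U →L[ℂ] V)),
        (∀ j, IsSchurAgler.{w} (S j)) →
          IsSchurAgler.{w} fun z => symProd fun j => S j z) ∧
    (∀ (n : ℕ) (S : (Fin d → ℂ) → Matrix (Fin n) (Fin n) ℂ), IsMatrixSchurAgler.{w} S →
        (∀ k : ℕ, IsMatrixSchurAgler.{w} fun z => permCompound k (S z)) ∧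
        (∀ k : ℕ, IsMatrixSchurAgler.{w} fun z => permInduced k (S z)) ∧
        IsScalarSchurAgler.{w} fun z => (S z).permanent) :=
  ⟨fun _ _ _ _ _ _ _ _ hS => isSchurAgler_symProd hS,
    fun _ _ hS => ⟨hS.permCompound, hS.permInduced, hS.permanent⟩⟩

theorem mainTheorem11 (d : ℕ) :
    (∀ (U : Type u) [NormedAddCommGroup U] [InnerProductSpace ℂ U] [CompleteSpace U]
        (V : Type v) [NormedAddCommGroup V] [InnerProductSpace ℂ V] [CompleteSpace V]
        (k : ℕ) (S : Fin k → (Fin d → ℂ) → (U →L[ℂ] V)),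
        (∀ j, IsSchurAgler.{w} (S j)) →
          IsSchurAgler.{w} fun z => symProd fun j => S j z) ∧
    (∀ (n : ℕ) (S : (Fin d → ℂ) → Matrix (Fin n) (Fin n) ℂ), IsMatrixSchurAgler.{w} S →
        (∀ k : ℕ, IsMatrixSchurAgler.{w} fun z => permCompound k (S z)) ∧
        (∀ k : ℕ, IsMatrixSchurAgler.{w} fun z => permInduced k (S z)) ∧
        IsScalarSchurAgler.{w} fun z => (S z).permanent) :=
  ⟨fun U _ _ _ V _ _ _ => (mainTheorem11_general d).1 U V,
    (mainTheorem11_general.{w, u, v} d).2⟩
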